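/- All graphs are finite and simple. For positive integers $n,k$, an $(n,k)$-graph is a graph whose vertex set is partitioned into $n$ parts, each of size at most $k$, such that no edge lies inside a part and there is exactly one edge between any two distinct parts. For a graph $H$ with maximum degree at least $2$, let $f(n,H)$ be the least positive integer $k$ such that there is an $(n,k)$-graph that does not contain $H$ as a (not necessarily induced) subgraph, and let $\mathrm{ex}(\ell,H)$ be the largest number of edges in an $\ell$-vertex graph that does not contain $H$ as a subgraph. Let $H$ be a bipartite graph with maximum degree at least $2$, and let $r$ be a real number such that $\mathrm{ex}(\ell,H)=\Theta(\ell^r)$ as $\ell\to\infty$. Then there are positive constants $C',C$ (depending only on $H$ and $r$) such that for every integer $n\ge 2$, $$C'\,n^{2/r-1}\;\le\; f(n,H)\;\le\; C\,n^{2/r-1}(\log n)^{1/r}.$$ -/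

import Mathlib

namespace SplitGraph

/-- `G` is an `(n, k)`-graph: its vertex set is partitioned into `n` blobs (the fibres of `b`), each
of size at most `k`, no edge lies inside a blob, and there is exactly one edge between any two
distinct blobs. -/
def IsNKGraph {V : Type} [Fintype V] (G : SimpleGraph V) (n k : ℕ) : Prop :=
  ∃ b : V → Fin n,
    (∀ i, (Finset.univ.filter fun v => b v = i).card ≤ k) ∧
    (∀ u v, G.Adj u v → b u ≠ b v) ∧
    ∀ i j, i ≠ j → ∃! e : V × V, b e.1 = i ∧ b e.2 = j ∧ G.Adj e.1 e.2

/-- The least positive integer `k` such that some `(n, k)`-graph contains no copy of `H` as a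
(not necessarily induced) subgraph. -/
noncomputable def f {W : Type*} (n : ℕ) (H : SimpleGraph W) : ℕ :=
  sInf {k : ℕ | 0 < k ∧
    ∃ (V : Type) (_ : Fintype V) (G : SimpleGraph V), IsNKGraph G n k ∧ H.Free G}

end SplitGraph

namespace SplitGraph

open Finset SimpleGraph Filter

/-! Lower bound: an `(n, k)`-graph has at most `nk` vertices and about `n²/2` edges, so `H`-freeness
forces `n² ≲ (nk)^r`.

Upper bound for `1 < r < 2`: take an extremal `H`-free graph on `l ≈ (n² log n)^(1/r)` vertices and
a cut `(A, B)` holding half its edges. Choose disjoint small sets `P i ⊆ A`, each with `M ≈ 3 n log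
n` neighbours in `B`, then colour `B` in `n` nearly equal classes so that each of these
neighbourhoods meets every class. Blob `i` is `P i` plus class `i`; any two blobs are joined,
surplus edges are dropped, and the sizes are `O(l / n)`.

The greedy choice (`exists_disjoint_family`) does not get stuck because `εl` vertices touch only
`O(ε^(r-1) l^r)` edges (`exists_interedges_le`). The colouring (`exists_balanced_colouring`) is a
union bound over `n²` pairs, each failing with probability at most `exp(-M/n)`.

Matchings give `r ≥ 1`, and Erdős–Stone for bipartite `H` gives `r < 2`. If `r = 1`, a matching
already suffices. -/

/-- Disjoint vertex sets of an `H`-free graph which are pairwise joined by an edge give rise to an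
`H`-free `(n, k)`-graph. -/
theorem exists_isNKGraph {W : Type*} {H : SimpleGraph W} {V : Type} [Fintype V]
    {G : SimpleGraph V} (hG : H.Free G) {n k : ℕ} (P : Fin n → Finset V)
    (hP : ∀ i j, i ≠ j → Disjoint (P i) (P j)) (hk : ∀ i, #(P i) ≤ k)
    (hE : ∀ i j, i < j → ∃ u ∈ P i, ∃ v ∈ P j, G.Adj u v) :
    ∃ (V' : Type) (_ : Fintype V') (G' : SimpleGraph V'), IsNKGraph G' n k ∧ H.Free G' := by
  classical
  choose u hu v hv huv using hE
  have uniq : ∀ {x i j}, x ∈ P i → x ∈ P j → i = j := by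
    intro x i j hi hj
    by_contra h
    exact Finset.disjoint_left.1 (hP i j h) hi hj
  let V' := {x : V // ∃ i, x ∈ P i}
  let b : V' → Fin n := fun x => x.2.choose
  have hb : ∀ x : V', x.1 ∈ P (b x) := fun x => x.2.choose_spec
  have hb' : ∀ (x : V') i, x.1 ∈ P i → b x = i := fun x i h => uniq (hb x) h
  -- Only the chosen edge of each pair of blobs is kept; `G'` maps injectively into `G`, so it stays
  -- `H`-free.
  let G' : SimpleGraph V' :=
    { Adj := fun x y => ∃ i j, ∃ h : i < j,
        (x.1 = u i j h ∧ y.1 = v i j h) ∨ (x.1 = v i j h ∧ y.1 = u i j h)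
      symm := ⟨by
        rintro x y ⟨i, j, h, hh⟩
        exact ⟨i, j, h, by tauto⟩⟩
      loopless := ⟨by
        rintro x ⟨i, j, h, hh | hh⟩
        · exact huv i j h |>.ne (hh.1.symm.trans hh.2)
        · exact huv i j h |>.ne (hh.2.symm.trans hh.1)⟩ }
  refine ⟨V', inferInstance, G', ⟨b, ?_, ?_, ?_⟩, ?_⟩
  · intro i
    refine le_trans ?_ (hk i)
    refine Finset.card_le_card_of_injOn Subtype.val ?_ Subtype.val_injective.injOn
    intro x hx
    have : b x = i := by simpa using hx
    exact this ▸ hb x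
  · rintro x y ⟨i, j, h, hh | hh⟩
    · rw [hb' x i (hh.1 ▸ hu i j h), hb' y j (hh.2 ▸ hv i j h)]
      exact h.ne
    · rw [hb' x j (hh.1 ▸ hv i j h), hb' y i (hh.2 ▸ hu i j h)]
      exact h.ne'
  · have key : ∀ i j (h : i < j), ∃ e : V' × V', (e.1.1 = u i j h ∧ e.2.1 = v i j h) :=
      fun i j h => ⟨(⟨u i j h, i, hu i j h⟩, ⟨v i j h, j, hv i j h⟩), rfl, rfl⟩
    have adj : ∀ x y i j (h : i < j), b x = i → b y = j → G'.Adj x y →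
        x.1 = u i j h ∧ y.1 = v i j h := by
      rintro x y i j h hx hy ⟨i', j', h', hh | hh⟩
      · have h1 := hb' x i' (hh.1 ▸ hu i' j' h')
        have h2 := hb' y j' (hh.2 ▸ hv i' j' h')
        obtain rfl : i = i' := hx.symm.trans h1
        obtain rfl : j = j' := hy.symm.trans h2
        exact hh
      · have h1 := hb' x j' (hh.1 ▸ hv i' j' h')
        have h2 := hb' y i' (hh.2 ▸ hu i' j' h')
        rw [hx] at h1
        rw [hy] at h2
        subst h1 h2
        exact absurd h h'.asymm
    intro i j hij
    rcases lt_or_gt_of_ne hij with h | h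
    · obtain ⟨e, he⟩ := key i j h
      refine ⟨e, ⟨hb' _ _ (he.1 ▸ hu i j h), hb' _ _ (he.2 ▸ hv i j h), i, j, h, Or.inl he⟩, ?_⟩
      rintro e' ⟨h1, h2, h3⟩
      have := adj _ _ i j h h1 h2 h3
      exact Prod.ext (Subtype.ext (this.1.trans he.1.symm)) (Subtype.ext (this.2.trans he.2.symm))
    · obtain ⟨e, he⟩ := key j i h
      refine ⟨e.swap, ⟨hb' _ _ (he.2 ▸ hv j i h), hb' _ _ (he.1 ▸ hu j i h), j, i, h,
        Or.inr he.symm⟩, ?_⟩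
      rintro e' ⟨h1, h2, h3⟩
      have := adj _ _ j i h h2 h1 h3.symm
      exact Prod.ext (Subtype.ext (this.2.trans he.2.symm)) (Subtype.ext (this.1.trans he.1.symm))
  · rintro ⟨φ⟩
    refine hG ⟨⟨⟨fun w => (φ w).1, ?_⟩, fun x y h => φ.injective (Subtype.ext h)⟩⟩
    intro x y hxy
    obtain ⟨i, j, h, hh | hh⟩ := φ.toHom.map_adj hxy
    · rw [show (φ x).1 = _ from hh.1, show (φ y).1 = _ from hh.2]
      exact huv i j h
    · rw [show (φ x).1 = _ from hh.1, show (φ y).1 = _ from hh.2]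
      exact (huv i j h).symm

/-- The perfect matching on ordered pairs is an `H`-free `(n, n)`-graph. -/
theorem exists_isNKGraph_self {W : Type*} [Fintype W] {H : SimpleGraph W} [DecidableRel H.Adj]
    (hdeg : 2 ≤ H.maxDegree) (n : ℕ) :
    ∃ (V : Type) (_ : Fintype V) (G : SimpleGraph V), IsNKGraph G n n ∧ H.Free G := by
  classical
  let G : SimpleGraph (Fin n × Fin n) :=
    { Adj := fun p q => p ≠ q ∧ q = p.swap
      symm := ⟨by rintro p q ⟨h, rfl⟩; exact ⟨h.symm, by simp⟩⟩
      loopless := ⟨fun p h => h.1 rfl⟩ }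
  have hG : H.Free G := by
    rintro ⟨φ⟩
    have : Nonempty W := by
      by_contra h
      rw [not_nonempty_iff] at h
      simp at hdeg
    obtain ⟨w, hw⟩ := H.exists_maximal_degree_vertex
    rw [hw, ← SimpleGraph.card_neighborFinset_eq_degree] at hdeg
    obtain ⟨x, hx, y, hy, hxy⟩ := Finset.one_lt_card.1 hdeg
    rw [SimpleGraph.mem_neighborFinset] at hx hy
    have h1 := (φ.toHom.map_adj hx).2
    have h2 := (φ.toHom.map_adj hy).2
    exact hxy (φ.injective (h1.trans h2.symm))
  refine exists_isNKGraph hG (fun i => univ.filter fun p => p.1 = i) ?_ ?_ ?_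
  · intro i j hij
    rw [Finset.disjoint_left]
    simp only [mem_filter, mem_univ, true_and]
    rintro x rfl h
    exact hij h
  · intro i
    refine (Finset.card_le_card_of_injOn Prod.snd (t := univ) (by simp) ?_).trans (by simp)
    rintro p hp q hq h
    simp only [coe_filter, mem_univ, true_and, Set.mem_ofPred_eq] at hp hq
    exact Prod.ext (hp.trans hq.symm) h
  · intro i j hij
    refine ⟨(i, j), by simp, (j, i), by simp, ?_, rfl⟩
    intro h
    exact hij.ne (Prod.ext_iff.1 h).1

theorem f_le {W : Type*} {H : SimpleGraph W} {n k : ℕ} (hk : 0 < k)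
    (h : ∃ (V : Type) (_ : Fintype V) (G : SimpleGraph V), IsNKGraph G n k ∧ H.Free G) :
    f n H ≤ k :=
  Nat.sInf_le ⟨hk, h⟩

theorem f_le_self {W : Type*} [Fintype W] {H : SimpleGraph W} [DecidableRel H.Adj]
    (hdeg : 2 ≤ H.maxDegree) {n : ℕ} (hn : 0 < n) : f n H ≤ n :=
  f_le hn (exists_isNKGraph_self hdeg n)

theorem f_spec {W : Type*} [Fintype W] {H : SimpleGraph W} [DecidableRel H.Adj]
    (hdeg : 2 ≤ H.maxDegree) {n : ℕ} (hn : 0 < n) :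
    ∃ (V : Type) (_ : Fintype V) (G : SimpleGraph V), IsNKGraph G n (f n H) ∧ H.Free G :=
  -- Nonemptiness matters: `sInf ∅ = 0` would be a junk value. The matching supplies `k = n`.
  (Nat.sInf_mem (s := {k : ℕ | 0 < k ∧
    ∃ (V : Type) (_ : Fintype V) (G : SimpleGraph V), IsNKGraph G n k ∧ H.Free G})
    ⟨n, hn, exists_isNKGraph_self hdeg n⟩).2

/-! ### Counting vertices and edges of `(n, k)`-graphs -/

theorem IsNKGraph.card_le {V : Type} [Fintype V] {G : SimpleGraph V} {n k : ℕ}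
    (h : IsNKGraph G n k) : Fintype.card V ≤ n * k := by
  obtain ⟨b, hb, -⟩ := h
  rw [← Finset.card_univ,
    Finset.card_eq_sum_card_fiberwise (f := b) (t := univ) (by simp [Set.MapsTo])]
  exact (Finset.sum_le_sum fun i _ => hb i).trans (by simp)

theorem IsNKGraph.le_card_edgeFinset {V : Type} [Fintype V] {G : SimpleGraph V}
    [DecidableRel G.Adj] {n k : ℕ} (h : IsNKGraph G n k) :
    n * (n - 1) ≤ 2 * #G.edgeFinset := by
  classical
  obtain ⟨b, -, -, hb⟩ := h
  choose e he _ using hb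
  rw [← SimpleGraph.dart_card_eq_twice_card_edges]
  have h1 : n * (n - 1) = Fintype.card (univ : Finset (Fin n)).offDiag := by
    rw [Fintype.card_coe, Finset.offDiag_card]
    simp [Nat.mul_sub]
  rw [h1]
  have hne : ∀ p : (univ : Finset (Fin n)).offDiag, p.1.1 ≠ p.1.2 := fun p =>
    (Finset.mem_offDiag.1 p.2).2.2
  refine Fintype.card_le_of_injective
    (fun p => (⟨e p.1.1 p.1.2 (hne p), (he _ _ (hne p)).2.2⟩ : G.Dart)) ?_
  intro p q hpq
  have h2 : e p.1.1 p.1.2 (hne p) = e q.1.1 q.1.2 (hne q) := congrArg SimpleGraph.Dart.toProd hpq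
  have hp := he _ _ (hne p)
  have hq := he _ _ (hne q)
  rw [h2] at hp
  exact Subtype.ext (Prod.ext (hp.1.symm.trans hq.1) (hp.2.1.symm.trans hq.2.1))

/-- An `H`-free `(n, k)`-graph bounds `n * (n - 1) / 2` by an extremal number. -/
theorem mul_pred_le_of_isNKGraph {W : Type*} {H : SimpleGraph W} {n k : ℕ} {c r : ℝ}
    (hc : 0 ≤ c) (hr : 0 ≤ r)
    (hex : ∀ l : ℕ, (extremalNumber l H : ℝ) ≤ c * (l : ℝ) ^ r)
    (h : ∃ (V : Type) (_ : Fintype V) (G : SimpleGraph V), IsNKGraph G n k ∧ H.Free G) :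
    (n : ℝ) * ((n - 1 : ℕ) : ℝ) ≤ 2 * c * ((n : ℝ) * k) ^ r := by
  classical
  obtain ⟨V, _, G, hG, hfree⟩ := h
  have h1 : (n : ℝ) * ((n - 1 : ℕ) : ℝ) ≤ 2 * (#G.edgeFinset : ℝ) :=
    mod_cast hG.le_card_edgeFinset
  have h2 : (#G.edgeFinset : ℝ) ≤ extremalNumber (Fintype.card V) H :=
    mod_cast card_edgeFinset_le_extremalNumber hfree
  have h3 : ((Fintype.card V : ℕ) : ℝ) ^ r ≤ ((n : ℝ) * k) ^ r :=
    Real.rpow_le_rpow (by positivity) (mod_cast hG.card_le) hr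
  have h4 := hex (Fintype.card V)
  nlinarith [mul_le_mul_of_nonneg_left h3 hc]

/-! ### Extremal numbers and the range of the exponent -/

theorem extremalNumber_zero {W : Type*} (H : SimpleGraph W) : extremalNumber 0 H = 0 := by
  classical
  rw [← Nat.le_zero, ← Fintype.card_fin 0, extremalNumber_le_iff]
  intro G _ _
  have : G.edgeFinset = ∅ := by
    ext e
    induction e with | _ x y => exact x.elim0
  simp [this]

/-- An asymptotic upper bound on extremal numbers holds for all sizes with a larger constant. -/
theorem exists_forall_extremalNumber_le {W : Type*} {H : SimpleGraph W} {r : ℝ}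
    (hex : (fun l : ℕ => (extremalNumber l H : ℝ)) =O[atTop] (fun l : ℕ => (l : ℝ) ^ r)) :
    ∃ c : ℝ, 0 < c ∧ ∀ l : ℕ, (extremalNumber l H : ℝ) ≤ c * (l : ℝ) ^ r := by
  obtain ⟨c, hc, h⟩ := hex.exists_pos
  rw [Asymptotics.isBigOWith_iff, eventually_atTop] at h
  obtain ⟨N, hN⟩ := h
  have hnn : ∀ i : ℕ, 0 ≤ (extremalNumber i H : ℝ) / (i : ℝ) ^ r := fun i => by positivity
  have hs : 0 ≤ ∑ i ∈ range N, (extremalNumber i H : ℝ) / (i : ℝ) ^ r :=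
    sum_nonneg fun i _ => hnn i
  -- The sum dominates the ratio at each of the finitely many sizes below `N`.
  refine ⟨c + ∑ i ∈ range N, (extremalNumber i H : ℝ) / (i : ℝ) ^ r, by linarith, fun l => ?_⟩
  have hl0 : 0 ≤ (l : ℝ) ^ r := by positivity
  rcases Nat.eq_zero_or_pos l with rfl | hl
  · rw [extremalNumber_zero]
    simpa using mul_nonneg (by linarith) hl0
  have hlr : 0 < (l : ℝ) ^ r := by positivity
  rcases le_or_gt N l with h | h
  · have := hN l h
    rw [Real.norm_of_nonneg (by positivity), Real.norm_of_nonneg hl0] at this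
    nlinarith
  · have := single_le_sum (f := fun i : ℕ => (extremalNumber i H : ℝ) / (i : ℝ) ^ r)
      (fun i _ => hnn i) (mem_range.2 h)
    rw [div_le_iff₀ hlr] at this
    nlinarith

theorem exists_le_extremalNumber {W : Type*} {H : SimpleGraph W} {r : ℝ}
    (hex : (fun l : ℕ => (l : ℝ) ^ r) =O[atTop] (fun l : ℕ => (extremalNumber l H : ℝ))) :
    ∃ c : ℝ, 0 < c ∧ ∃ N : ℕ, ∀ l : ℕ, N ≤ l → c * (l : ℝ) ^ r ≤ extremalNumber l H := by
  obtain ⟨c, hc, h⟩ := hex.exists_pos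
  rw [Asymptotics.isBigOWith_iff, eventually_atTop] at h
  obtain ⟨N, hN⟩ := h
  refine ⟨c⁻¹, by positivity, N, fun l hl => ?_⟩
  have := hN l hl
  rw [Real.norm_of_nonneg (by positivity), Real.norm_of_nonneg (by positivity)] at this
  rwa [inv_mul_le_iff₀ hc]

/-- The matching that forms an `(n, n)`-graph is `H`-free and has about `n²/2` edges on `n²`
vertices, so extremal numbers grow at least linearly. -/
theorem one_le_of_extremalNumber_le {W : Type*} [Fintype W] {H : SimpleGraph W}
    [DecidableRel H.Adj] (hdeg : 2 ≤ H.maxDegree) {c r : ℝ} (hc : 0 < c)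
    (hex : ∀ l : ℕ, (extremalNumber l H : ℝ) ≤ c * (l : ℝ) ^ r) : 1 ≤ r := by
  by_contra! hr
  -- A priori `r` may be negative, while monotonicity of `x ^ r` needs a nonnegative exponent.
  set s := max r 0 with hs
  have hs1 : s < 1 := max_lt hr one_pos
  have hs0 : 0 ≤ s := le_max_right _ _
  have hex' : ∀ l : ℕ, (extremalNumber l H : ℝ) ≤ c * (l : ℝ) ^ s := by
    intro l
    rcases Nat.eq_zero_or_pos l with rfl | hl
    · rw [extremalNumber_zero, Nat.cast_zero]
      positivity
    · refine (hex l).trans (mul_le_mul_of_nonneg_left ?_ hc.le)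
      exact Real.rpow_le_rpow_of_exponent_le (mod_cast hl) (le_max_left _ _)
  have key : ∀ n : ℕ, 2 ≤ n → (n : ℝ) ^ (2 - 2 * s) ≤ 4 * c := by
    intro n hn
    have h := mul_pred_le_of_isNKGraph hc.le hs0 hex' (exists_isNKGraph_self hdeg n)
    have hn' : (2 : ℝ) ≤ n := mod_cast hn
    rw [Nat.cast_sub (by omega), Nat.cast_one] at h
    have h2 : ((n : ℝ) * n) ^ s = (n : ℝ) ^ (2 * s) := by
      rw [Real.mul_rpow (by positivity) (by positivity), ← Real.rpow_add (by positivity)]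
      ring_nf
    rw [h2] at h
    have hp : 0 < (n : ℝ) ^ (2 * s) := by positivity
    rw [Real.rpow_sub (by positivity), div_le_iff₀ hp, Real.rpow_two]
    nlinarith
  have ht : Tendsto (fun n : ℕ => (n : ℝ) ^ (2 - 2 * s)) atTop atTop :=
    (tendsto_rpow_atTop (by linarith)).comp tendsto_natCast_atTop_atTop
  obtain ⟨n, hn, hn2⟩ := ((ht.eventually_gt_atTop (4 * c)).and (eventually_ge_atTop 2)).exists
  exact absurd (key n hn2) (not_le.2 hn)

/-- `H` embeds in a balanced complete bipartite graph, so by the minimum-degree Erdős–Stone theorem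
a large `H`-free graph has a vertex of degree below `(c/2) n`. Deleting such vertices one at a time
bounds the extremal number by about `(c/2) l²`, too small for `r ≥ 2`. -/
theorem lt_two_of_le_extremalNumber {W : Type*} [Fintype W] {H : SimpleGraph W}
    (hbip : H.IsBipartite) (hne : H ≠ ⊥) {c r : ℝ} (hc : 0 < c) {N : ℕ}
    (hex : ∀ l : ℕ, N ≤ l → c * (l : ℝ) ^ r ≤ extremalNumber l H) : r < 2 := by
  classical
  by_contra! hr
  obtain ⟨C⟩ := hbip
  have hK : H ⊑ completeEquipartiteGraph (1 + 1) (Fintype.card W) :=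
    isContained_completeEquipartiteGraph_of_colorable C _ fun c => by
      exact Fintype.card_subtype_le _
  have hES := eventually_completeEquipartiteGraph_isContained_of_minDegree
    (half_pos hc) 1 (Fintype.card W)
  obtain ⟨n₀, hn₀⟩ := eventually_atTop.1 hES
  have step : ∀ n, n₀ ≤ n + 1 →
      (extremalNumber (n + 1) H : ℝ) ≤ extremalNumber n H + c / 2 * (n + 1) := by
    intro n hn
    obtain ⟨G, hdec, hG⟩ := exists_isExtremal_free (V := Fin (n + 1)) hne
    have hfree := hG.prop
    have hcard := card_edgeFinset_of_isExtremal_free hG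
    rw [Fintype.card_fin] at hcard
    have hmin : (G.minDegree : ℝ) < c / 2 * (n + 1) := by
      by_contra! h
      refine hfree (hK.trans (hn₀ (n + 1) hn ?_))
      push_cast
      linarith
    obtain ⟨v, hv⟩ := G.exists_minimal_degree_vertex
    have h1 := card_edgeFinset_deleteIncidenceSet_le_extremalNumber hfree v
    rw [card_edgeFinset_deleteIncidenceSet, ← hv, hcard, Fintype.card_fin,
      Nat.add_sub_cancel] at h1
    have h2 : (extremalNumber (n + 1) H : ℝ) ≤ extremalNumber n H + G.minDegree := by
      exact_mod_cast Nat.sub_le_iff_le_add.1 h1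
    linarith
  have bound : ∀ m : ℕ, (extremalNumber (n₀ + m) H : ℝ) ≤
      extremalNumber n₀ H + c / 2 * (m * (n₀ + m)) := by
    intro m
    induction m with
    | zero => simp
    | succ m ih =>
      have := step (n₀ + m) (by omega)
      rw [← add_assoc]
      push_cast at this ⊢
      nlinarith [show 0 ≤ c * m by positivity]
  -- With this `m`, the constant term is below `(c/2) l²` at `l = n₀ + m + N + 1`; the summand `N`
  -- makes `hex` applicable.
  obtain ⟨m, hm⟩ := exists_nat_gt (2 * (extremalNumber n₀ H : ℝ) / c)
  have h1 := bound (m + N + 1)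
  have h2 := hex (n₀ + (m + N + 1)) (by omega)
  have h3 : (((n₀ + (m + N + 1) : ℕ) : ℝ)) ^ (2 : ℝ) ≤ ((n₀ + (m + N + 1) : ℕ) : ℝ) ^ r :=
    Real.rpow_le_rpow_of_exponent_le (by exact_mod_cast (by omega)) hr
  rw [Real.rpow_two] at h3
  rw [div_lt_iff₀ hc] at hm
  have h4 := mul_le_mul_of_nonneg_left h3 hc.le
  push_cast at h1 h2 h4
  set x : ℝ := (m : ℝ) + N + 1
  have hx : (m : ℝ) + 1 ≤ x := by simp only [x]; linarith [Nat.cast_nonneg (α := ℝ) N]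
  have hn0 : (0 : ℝ) ≤ n₀ := by positivity
  have hm0 : (0 : ℝ) ≤ m := by positivity
  have h5 : c * ((n₀ : ℝ) + x) ^ 2 ≤ extremalNumber n₀ H + c / 2 * (x * (n₀ + x)) := by linarith
  have h6 : (m : ℝ) ≤ (n₀ + x) ^ 2 := by nlinarith
  have h7 : x * (n₀ + x) ≤ (n₀ + x) ^ 2 := by nlinarith
  nlinarith

/-! ### Small sets touch few edges; large cuts -/

theorem card_interedges_self_le {W V : Type*} {H : SimpleGraph W} [Fintype V]
    {G : SimpleGraph V} [DecidableRel G.Adj] (hG : H.Free G) (S : Finset V) :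
    #(G.interedges S S) ≤ 2 * extremalNumber #S H := by
  classical
  have hfree : H.Free (G.induce (S : Set V)) := fun h => hG (h.trans ⟨Copy.induce G _⟩)
  have h1 := card_edgeFinset_le_extremalNumber hfree
  rw [show Fintype.card (S : Set V) = #S by simp] at h1
  refine le_trans ?_ (Nat.mul_le_mul_left 2 h1)
  rw [← dart_card_eq_twice_card_edges, ← Fintype.card_coe]
  have hm : ∀ e : G.interedges S S, e.1.1 ∈ S ∧ e.1.2 ∈ S ∧ G.Adj e.1.1 e.1.2 :=
    fun e => Rel.mem_interedges_iff.1 e.2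
  refine Fintype.card_le_of_injective (fun e => (⟨(⟨e.1.1, (hm e).1⟩, ⟨e.1.2, (hm e).2.1⟩),
    (hm e).2.2⟩ : (G.induce (S : Set V)).Dart)) ?_
  intro e e' h
  have h2 := congrArg SimpleGraph.Dart.toProd h
  simp only [Prod.mk.injEq, Subtype.mk.injEq] at h2
  exact Subtype.ext (Prod.ext h2.1 h2.2)

theorem card_interedges_univ {V : Type*} [Fintype V] (G : SimpleGraph V) [DecidableRel G.Adj] :
    #(G.interedges univ univ) = 2 * #G.edgeFinset := by
  classical
  rw [← dart_card_eq_twice_card_edges, ← Fintype.card_coe]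
  refine Fintype.card_congr ⟨fun e => ⟨e.1, (Rel.mem_interedges_iff.1 e.2).2.2⟩,
    fun d => ⟨d.toProd, Rel.mem_interedges_iff.2 ⟨mem_univ _, mem_univ _, d.adj⟩⟩,
    fun _ => rfl, fun _ => rfl⟩

/-- In an `H`-free graph a small set of vertices touches few edges: the remaining vertices are cut
into pieces of size at most `s`. -/
theorem card_interedges_univ_right_le {W : Type*} {H : SimpleGraph W} {l : ℕ}
    {G : SimpleGraph (Fin l)} [DecidableRel G.Adj] (hG : H.Free G) {c r : ℝ} (hc : 0 ≤ c)
    (hr : 0 ≤ r) (hex : ∀ l : ℕ, (extremalNumber l H : ℝ) ≤ c * (l : ℝ) ^ r) {s : ℕ} (hs : 0 < s)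
    (S : Finset (Fin l)) (hS : #S ≤ s) :
    (#(G.interedges S univ) : ℝ) ≤ ((l / s : ℕ) + 1) * (2 * c * (2 * s : ℝ) ^ r) := by
  classical
  -- Consecutive intervals of length `s`: each spans with `S` at most `2s` vertices.
  let T : ℕ → Finset (Fin l) := fun a => univ.filter fun v => v.1 / s = a
  have hT : ∀ a, #(T a) ≤ s := by
    intro a
    refine (Finset.card_le_card_of_injOn (fun v => v.1 % s) (t := range s) ?_ ?_).trans (by simp)
    · intro v _
      simpa using Nat.mod_lt _ hs
    · intro v hv w hw h
      have hv' : v.1 / s = a := by simpa [T] using hv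
      have hw' : w.1 / s = a := by simpa [T] using hw
      have h' : v.1 % s = w.1 % s := h
      ext
      rw [← Nat.div_add_mod v.1 s, ← Nat.div_add_mod w.1 s, hv', hw', h']
  have hpiece : ∀ a, (#(G.interedges S (T a)) : ℝ) ≤ 2 * c * (2 * s : ℝ) ^ r := by
    intro a
    have h1 : #(G.interedges S (T a)) ≤ 2 * extremalNumber #(S ∪ T a) H :=
      (card_le_card (Rel.interedges_mono subset_union_left subset_union_right)).trans
        (card_interedges_self_le hG (S ∪ T a))
    have h2 : ((#(S ∪ T a) : ℕ) : ℝ) ≤ 2 * s := by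
      have := (card_union_le S (T a)).trans (add_le_add hS (hT a))
      exact_mod_cast (by omega)
    have h3 := Real.rpow_le_rpow (by positivity) h2 hr
    have h4 := hex #(S ∪ T a)
    have h5 : (#(G.interedges S (T a)) : ℝ) ≤ 2 * (extremalNumber #(S ∪ T a) H : ℝ) :=
      mod_cast h1
    nlinarith [mul_le_mul_of_nonneg_left h3 hc]
  have hsum : #(G.interedges S univ) ≤ ∑ a ∈ range (l / s + 1), #(G.interedges S (T a)) := by
    refine le_trans (card_le_card ?_) card_biUnion_le
    rintro ⟨x, y⟩ h
    rw [SimpleGraph.mem_interedges_iff] at h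
    rw [mem_biUnion]
    refine ⟨y.1 / s, ?_, ?_⟩
    · rw [mem_range, Nat.lt_succ_iff]
      exact Nat.div_le_div_right y.2.le
    · rw [SimpleGraph.mem_interedges_iff]
      exact ⟨h.1, by simp [T], h.2.2⟩
  have hsum' : (#(G.interedges S univ) : ℝ) ≤
      ∑ a ∈ range (l / s + 1), (#(G.interedges S (T a)) : ℝ) := by exact_mod_cast hsum
  refine hsum'.trans ((sum_le_sum fun a _ => hpiece a).trans ?_)
  simp

/-- Every finite weighted graph has a cut of at least half of the total weight. -/
theorem exists_cut {V : Type*} [DecidableEq V] (a : V → V → ℕ) (hsymm : ∀ x y, a x y = a y x)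
    (hdiag : ∀ x, a x x = 0) (S : Finset V) :
    ∃ A B : Finset V, A ∪ B = S ∧ Disjoint A B ∧
      ∑ x ∈ S, ∑ y ∈ S, a x y ≤ 4 * ∑ x ∈ A, ∑ y ∈ B, a x y := by
  induction S using Finset.induction_on with
  | empty => exact ⟨∅, ∅, by simp, by simp, by simp⟩
  | insert v S hv ih =>
    obtain ⟨A, B, hS, hd, h⟩ := ih
    have hvA : v ∉ A := fun h => hv (hS ▸ mem_union_left _ h)
    have hvB : v ∉ B := fun h => hv (hS ▸ mem_union_right _ h)
    have e1 : ∑ x ∈ insert v S, ∑ y ∈ insert v S, a x y =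
        ∑ x ∈ S, ∑ y ∈ S, a x y + 2 * ∑ y ∈ S, a v y := by
      simp only [sum_insert hv, sum_add_distrib, hdiag, hsymm _ v]
      ring
    have e2 : ∑ y ∈ S, a v y = ∑ y ∈ A, a v y + ∑ y ∈ B, a v y := by
      rw [← hS, sum_union hd]
    -- The new vertex joins the side to which it sends less weight, so at least half its weight is
    -- cut.
    rcases le_total (∑ y ∈ A, a v y) (∑ y ∈ B, a v y) with hle | hle
    · refine ⟨insert v A, B, by rw [insert_union, hS], by simp [hvB, hd], ?_⟩
      rw [e1, e2, sum_insert hvA]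
      omega
    · refine ⟨A, insert v B, by rw [union_insert, hS], by simp [hvA, hd], ?_⟩
      rw [e1, e2]
      simp only [sum_insert hvB, sum_add_distrib, hsymm _ v]
      omega

theorem exists_card_edgeFinset_le_card_interedges {V : Type*} [Fintype V] (G : SimpleGraph V)
    [DecidableRel G.Adj] :
    ∃ A B : Finset V, Disjoint A B ∧ #G.edgeFinset ≤ 2 * #(G.interedges A B) := by
  classical
  obtain ⟨A, B, -, hd, h⟩ := exists_cut (fun x y => if G.Adj x y then 1 else 0)
    (fun x y => by simp only [G.adj_comm]) (by simp) (univ : Finset V)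
  have key : ∀ S T : Finset V,
      #(G.interedges S T) = ∑ x ∈ S, ∑ y ∈ T, if G.Adj x y then 1 else 0 := by
    intro S T
    rw [SimpleGraph.interedges, Rel.interedges, card_filter, sum_product]
  rw [← key, ← key, card_interedges_univ] at h
  exact ⟨A, B, hd, by omega⟩

/-! ### Greedy choice of disjoint sets with many neighbours -/

section Greedy

variable {V : Type*} [Fintype V] [DecidableEq V] (G : SimpleGraph V) [DecidableRel G.Adj]

/-- The vertices of `B` with a neighbour in `P`. -/
def nbrs (B P : Finset V) : Finset V := P.biUnion fun a => B.filter (G.Adj a)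

variable {G} {A B : Finset V} {η d : ℝ} {s : ℕ}

/-- Discarding the edges that meet `U` or `N` costs at most `2η`; the rest still average at least
`d` per vertex. -/
theorem exists_many_new_nbrs (hs : ∀ S : Finset V, #S ≤ s → (#(G.interedges S univ) : ℝ) ≤ η)
    (hd : 0 ≤ d) (hAB : 2 * η + d * Fintype.card V < #(G.interedges A B)) {U N : Finset V}
    (hU : #U ≤ s) (hN : #N ≤ s) : ∃ a ∈ A \ U, d ≤ #(B.filter (G.Adj a) \ N) := by
  by_contra! h
  have h1 : #(G.interedges A B) ≤
      #(G.interedges U univ) + #(G.interedges univ N) + #(G.interedges (A \ U) (B \ N)) := by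
    refine (card_le_card ?_).trans
      ((card_union_le _ _).trans (Nat.add_le_add_right (card_union_le _ _) _))
    rintro ⟨x, y⟩ hxy
    simp only [SimpleGraph.mem_interedges_iff, mem_union, Finset.mem_sdiff, mem_univ, true_and] at hxy ⊢
    tauto
  have h2 : #(G.interedges univ N) = #(G.interedges N univ) :=
    have := G.symm
    Rel.card_interedges_comm _ _
  have h3 : (#(G.interedges (A \ U) (B \ N)) : ℝ) ≤ d * Fintype.card V := by
    have e : #(G.interedges (A \ U) (B \ N)) = ∑ a ∈ A \ U, #(B.filter (G.Adj a) \ N) := by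
      rw [SimpleGraph.interedges, Rel.interedges, card_filter, sum_product]
      refine sum_congr rfl fun a _ => ?_
      rw [← card_filter]
      congr 1
      ext y
      simp only [mem_filter, Finset.mem_sdiff]
      tauto
    rw [e]
    push_cast
    refine (sum_le_sum fun a ha => (h a ha).le).trans ?_
    rw [sum_const, nsmul_eq_mul, mul_comm]
    exact mul_le_mul_of_nonneg_left (mod_cast card_le_univ _) hd
  have h4 := hs U hU
  have h5 := hs N hN
  rw [h2] at h1
  have h1' : (#(G.interedges A B) : ℝ) ≤
    #(G.interedges U univ) + #(G.interedges N univ) + #(G.interedges (A \ U) (B \ N)) := mod_cast h1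
  linarith

/-- Each added vertex brings `d` new neighbours, so `t` rounds suffice. Until `M` is reached the
neighbourhood has size at most `s`, as the previous lemma requires. -/
theorem exists_set_many_nbrs (hs : ∀ S : Finset V, #S ≤ s → (#(G.interedges S univ) : ℝ) ≤ η)
    (hd : 0 ≤ d) (hAB : 2 * η + d * Fintype.card V < #(G.interedges A B)) {U : Finset V}
    (hU : #U ≤ s) {M t : ℕ} (hM : M ≤ s) (ht : M ≤ t * d) :
    ∃ P ⊆ A, Disjoint P U ∧ #P ≤ t ∧ M ≤ #(nbrs G B P) := by
  have key : ∀ j : ℕ, ∃ P ⊆ A, Disjoint P U ∧ #P ≤ j ∧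
      (M ≤ #(nbrs G B P) ∨ j * d ≤ #(nbrs G B P)) := by
    intro j
    induction j with
    | zero => exact ⟨∅, by simp, by simp, by simp, Or.inr (by simp)⟩
    | succ j ih =>
      obtain ⟨P, hPA, hPU, hPj, h⟩ := ih
      by_cases hM' : M ≤ #(nbrs G B P)
      · exact ⟨P, hPA, hPU, hPj.trans (Nat.le_succ j), Or.inl hM'⟩
      have h := h.resolve_left hM'
      obtain ⟨a, ha, hda⟩ := exists_many_new_nbrs hs hd hAB hU
        (N := nbrs G B P) ((le_of_not_ge hM').trans hM)
      rw [Finset.mem_sdiff] at ha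
      refine ⟨insert a P, insert_subset ha.1 hPA, by simp [ha.2, hPU],
        (card_insert_le _ _).trans (by omega), Or.inr ?_⟩
      have e : nbrs G B (insert a P) = nbrs G B P ∪ (B.filter (G.Adj a) \ nbrs G B P) := by
        rw [union_sdiff_self_eq_union, nbrs, biUnion_insert, union_comm, nbrs]
      rw [e, card_union_of_disjoint disjoint_sdiff]
      push_cast
      linarith
  obtain ⟨P, h1, h2, h3, h4⟩ := key t
  refine ⟨P, h1, h2, h3, h4.elim id fun h => ?_⟩
  exact_mod_cast ht.trans h

theorem exists_disjoint_family (hs : ∀ S : Finset V, #S ≤ s → (#(G.interedges S univ) : ℝ) ≤ η)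
    (hd : 0 ≤ d) (hAB : 2 * η + d * Fintype.card V < #(G.interedges A B)) {M t n : ℕ}
    (hM : M ≤ s) (ht : M ≤ t * d) (hn : n * t ≤ s) :
    ∃ P : ℕ → Finset V, (∀ i < n, P i ⊆ A ∧ #(P i) ≤ t ∧ M ≤ #(nbrs G B (P i))) ∧
      ∀ i < n, ∀ j < n, i ≠ j → Disjoint (P i) (P j) := by
  suffices h : ∀ m ≤ n, ∃ P : ℕ → Finset V,
      (∀ i < m, P i ⊆ A ∧ #(P i) ≤ t ∧ M ≤ #(nbrs G B (P i))) ∧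
      ∀ i < m, ∀ j < m, i ≠ j → Disjoint (P i) (P j) from h n le_rfl
  intro m
  induction m with
  | zero => exact fun _ => ⟨fun _ => ∅, by simp, by simp⟩
  | succ m ih =>
    intro hm
    obtain ⟨P, h1, h2⟩ := ih (by omega)
    have hU : #((range m).biUnion P) ≤ s := by
      refine (card_biUnion_le_card_mul _ _ t fun i hi => (h1 i (mem_range.1 hi)).2.1).trans ?_
      rw [card_range]
      exact (Nat.mul_le_mul_right t (by omega)).trans hn
    obtain ⟨Q, hQA, hQU, hQ⟩ := exists_set_many_nbrs hs hd hAB hU hM ht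
    have hQd : ∀ i < m, Disjoint Q (P i) := fun i hi =>
      hQU.mono_right (subset_biUnion_of_mem P (mem_range.2 hi))
    refine ⟨Function.update P m Q, fun i hi => ?_, fun i hi j hj hij => ?_⟩
    · rcases eq_or_ne i m with rfl | him
      · simpa using ⟨hQA, hQ⟩
      · rw [Function.update_of_ne him]
        exact h1 i (by omega)
    · rcases eq_or_ne i m with rfl | him
      · rw [Function.update_self, Function.update_of_ne hij.symm]
        exact hQd j (by omega)
      · rw [Function.update_of_ne him]
        rcases eq_or_ne j m with rfl | hjm
        · rw [Function.update_self]
          exact (hQd i (by omega)).symm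
        · rw [Function.update_of_ne hjm]
          exact h2 i (by omega) j (by omega) hij

end Greedy

/-! ### Random balanced colouring -/

/-- If `M / n` is large compared with `log n`, then `Fin l` has an almost balanced colouring with
`n` colours such that each of `n` given sets of size `M` contains all colours: cut `Fin l` into rows
of length `n` and shift the colours in each row by a random amount. -/
theorem exists_balanced_colouring {l n M : ℕ} (hn : 0 < n) (N : Fin n → Finset (Fin l))
    (hN : ∀ i, M ≤ #(N i)) (hM : (n : ℝ) * n * Real.exp (-(M / n : ℝ)) < 1) :
    ∃ col : Fin l → Fin n, (∀ j, #(univ.filter fun v => col v = j) ≤ l / n + 1) ∧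
      ∀ i j, ∃ v ∈ N i, col v = j := by
  classical
  have : NeZero n := ⟨hn.ne'⟩
  have hn' : (0 : ℝ) < n := mod_cast hn
  let q := l / n + 1
  let row : Fin l → Fin q := fun v => ⟨v.1 / n, Nat.lt_succ_of_le (Nat.div_le_div_right v.2.le)⟩
  have hinj : ∀ v w : Fin l, row v = row w → (v.1 : ZMod n) = (w.1 : ZMod n) → v = w := by
    intro v w h1 h2
    rw [ZMod.natCast_eq_natCast_iff'] at h2
    have h1' : v.1 / n = w.1 / n := congrArg Fin.val h1
    ext
    rw [← Nat.div_add_mod v.1 n, ← Nat.div_add_mod w.1 n, h1', h2]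
  -- The shift vectors for which the set `N p.1` misses colour `p.2`; probabilities are expressed as
  -- counts out of `n ^ q`.
  let bad : Fin n × ZMod n → Finset (Fin q → ZMod n) := fun p =>
    univ.filter fun x => ∀ v ∈ N p.1, (v.1 : ZMod n) + x (row v) ≠ p.2
  have hbad : ∀ p, (#(bad p) : ℝ) ≤ (n : ℝ) ^ q * Real.exp (-(M / n : ℝ)) := by
    rintro ⟨i, j⟩
    -- The shifts of row `a` that give some vertex of `N i` colour `j`. A bad vector avoids `R a` in
    -- every row independently, and the sizes of the `R a` sum to `#(N i)`.
    let R : Fin q → Finset (ZMod n) := fun a =>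
      ((N i).filter fun v => row v = a).image fun v => j - (v.1 : ZMod n)
    have hR : ∀ a, #(R a) = #((N i).filter fun v => row v = a) := by
      intro a
      refine card_image_of_injOn ?_
      intro v hv w hw h
      simp only [coe_filter, Set.mem_ofPred_eq] at hv hw
      exact hinj v w (hv.2.trans hw.2.symm) (sub_right_injective h)
    have hsub : bad (i, j) ⊆ Fintype.piFinset fun a => (R a)ᶜ := by
      intro x hx
      rw [Fintype.mem_piFinset]
      intro a
      rw [mem_compl]
      intro ha
      obtain ⟨v, hv, hva⟩ := mem_image.1 ha
      obtain ⟨hv1, rfl⟩ := mem_filter.1 hv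
      refine (mem_filter.1 hx).2 v hv1 ?_
      rw [← hva]
      ring
    have h1 : (#(bad (i, j)) : ℝ) ≤ ∏ a, (#((R a)ᶜ) : ℝ) := by
      have := card_le_card hsub
      rw [Fintype.card_piFinset] at this
      exact_mod_cast this
    have h2 : ∀ a, (#((R a)ᶜ) : ℝ) ≤ n * Real.exp (-(#(R a) / n : ℝ)) := by
      intro a
      have e : (#((R a)ᶜ) : ℝ) = n - #(R a) := by
        rw [card_compl, ZMod.card, Nat.cast_sub]
        exact (card_le_univ _).trans (ZMod.card n).le
      rw [e]
      have h3 := Real.add_one_le_exp (-(#(R a) / n : ℝ))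
      calc (n : ℝ) - #(R a) = n * (-(#(R a) / n : ℝ) + 1) := by field_simp; ring
        _ ≤ _ := mul_le_mul_of_nonneg_left h3 hn'.le
    have h3 : (M : ℝ) ≤ ∑ a, (#(R a) : ℝ) := by
      simp only [hR]
      have := card_eq_sum_card_fiberwise (s := N i) (f := row) (t := univ) (by simp [Set.MapsTo])
      have h4 := hN i
      rw [this] at h4
      exact_mod_cast h4
    calc (#(bad (i, j)) : ℝ) ≤ ∏ a, (#((R a)ᶜ) : ℝ) := h1
      _ ≤ ∏ a : Fin q, (n * Real.exp (-(#(R a) / n : ℝ))) :=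
        prod_le_prod (fun _ _ => by positivity) fun a _ => h2 a
      _ = (n : ℝ) ^ q * Real.exp (-((∑ a, (#(R a) : ℝ)) / n)) := by
        rw [prod_mul_distrib, prod_const, card_univ, Fintype.card_fin, ← Real.exp_sum,
          sum_neg_distrib, sum_div]
      _ ≤ _ := by gcongr
  have hex : ∃ x : Fin q → ZMod n, x ∉ univ.biUnion bad := by
    by_contra! h
    have h1 : (univ : Finset (Fin q → ZMod n)) = univ.biUnion bad :=
      (eq_univ_of_forall h).symm
    have h2 : (#(univ : Finset (Fin q → ZMod n)) : ℝ) = (n : ℝ) ^ q := by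
      simp [ZMod.card]
    have h3 : (#(univ.biUnion bad) : ℝ) ≤ ∑ p, (#(bad p) : ℝ) := mod_cast card_biUnion_le
    have h4 : ∑ p, (#(bad p) : ℝ) ≤ (n : ℝ) ^ q * ((n : ℝ) * n * Real.exp (-(M / n : ℝ))) := by
      refine (sum_le_sum fun p _ => hbad p).trans (le_of_eq ?_)
      simp [ZMod.card]
      ring
    rw [← h1, h2] at h3
    have h5 : (n : ℝ) ^ q * ((n : ℝ) * n * Real.exp (-(M / n : ℝ))) < (n : ℝ) ^ q * 1 :=
      mul_lt_mul_of_pos_left hM (by positivity)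
    linarith
  obtain ⟨x, hx⟩ := hex
  let e : ZMod n ≃ Fin n := Fintype.equivFinOfCardEq (ZMod.card n)
  refine ⟨fun v => e ((v.1 : ZMod n) + x (row v)), fun j => ?_, fun i j => ?_⟩
  -- A colour occurs at most once in each row, and there are `l / n + 1` rows.
  · refine (Finset.card_le_card_of_injOn row (t := univ) (by simp) ?_).trans (by simp [q])
    intro v hv w hw h
    simp only [coe_filter, mem_univ, true_and, Set.mem_ofPred_eq] at hv hw
    have h1 := e.injective (hv.trans hw.symm)
    rw [h] at h1
    exact hinj v w h (add_right_cancel h1)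
  · by_contra! h
    refine hx (mem_biUnion.2 ⟨(i, e.symm j), mem_univ _, mem_filter.2 ⟨mem_univ _, ?_⟩⟩)
    intro v hv hvj
    refine h v hv ?_
    rw [hvj, e.apply_symm_apply]

/-! ### Assembling the blobs and choosing the parameters -/

/-- Blob `i` is `P i` together with colour class `i` of `B`. Since the neighbourhood of `P i`
contains colour `j`, blobs `i` and `j` are joined. The outer factor 2 in `hE` pays for passing to a
cut. -/
theorem exists_isNKGraph_of_dense {W : Type*} {H : SimpleGraph W} {l n s t M : ℕ} {η d : ℝ}
    {G : SimpleGraph (Fin l)} [DecidableRel G.Adj] (hG : H.Free G)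
    (hs : ∀ S : Finset (Fin l), #S ≤ s → (#(G.interedges S univ) : ℝ) ≤ η) (hd : 0 ≤ d)
    (hE : 2 * (2 * η + d * l) < #G.edgeFinset) (hn : 0 < n) (hM : M ≤ s) (ht : M ≤ t * d)
    (hnt : n * t ≤ s) (hexp : (n : ℝ) * n * Real.exp (-(M / n : ℝ)) < 1) :
    ∃ (V : Type) (_ : Fintype V) (G' : SimpleGraph V),
      IsNKGraph G' n (t + (l / n + 1)) ∧ H.Free G' := by
  obtain ⟨A, B, hAB, hcut⟩ := exists_card_edgeFinset_le_card_interedges G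
  have hcut' : (#G.edgeFinset : ℝ) ≤ 2 * #(G.interedges A B) := mod_cast hcut
  obtain ⟨P, hP, hPd⟩ := exists_disjoint_family (A := A) (B := B) (n := n) hs hd
    (by rw [Fintype.card_fin]; linarith) hM ht hnt
  obtain ⟨col, hcol, hall⟩ := exists_balanced_colouring hn
    (fun i : Fin n => nbrs G B (P i)) (fun i => (hP i i.2).2.2) hexp
  refine exists_isNKGraph hG (fun i => P i ∪ B.filter fun v => col v = i) ?_ ?_ ?_
  · intro i j hij
    have hA : ∀ i j : Fin n, Disjoint (P i) (B.filter fun v => col v = j) := fun i j =>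
      hAB.mono (hP i i.2).1 (filter_subset _ _)
    rw [disjoint_union_left, disjoint_union_right, disjoint_union_right]
    refine ⟨⟨hPd i i.2 j j.2 (Fin.val_injective.ne hij), hA i j⟩, (hA j i).symm, ?_⟩
    rw [Finset.disjoint_left]
    intro v hv hv'
    exact hij ((mem_filter.1 hv).2.symm.trans (mem_filter.1 hv').2)
  · intro i
    refine (card_union_le _ _).trans (add_le_add (hP i i.2).2.1 (le_trans ?_ (hcol i)))
    exact card_le_card (filter_subset_filter _ (subset_univ _))
  · intro i j _
    obtain ⟨v, hv, hvj⟩ := hall i j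
    obtain ⟨u, hu, huv⟩ := mem_biUnion.1 hv
    obtain ⟨hvB, hadj⟩ := mem_filter.1 huv
    exact ⟨u, mem_union_left _ hu, v, mem_union_right _ (mem_filter.2 ⟨hvB, hvj⟩), hadj⟩

/-- After division this says `(log n)^(1 - 1/r) ≲ n^(2/r - 1)`, a logarithm against a positive power
because `r < 2`. It lets neighbourhoods of size about `n log n` fit into `εl` vertices. -/
theorem exists_mul_log_le {r : ℝ} (h1 : 1 < r) (h2 : r < 2) :
    ∃ K : ℝ, 0 < K ∧ ∀ n : ℕ, 2 ≤ n →
      (n : ℝ) * Real.log n ≤ K * ((n : ℝ) ^ 2 * Real.log n) ^ (1 / r) := by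
  have hr : 0 < r := by linarith
  have hθ : 0 < 1 - 1 / r := by
    rw [sub_pos, div_lt_one hr]
    exact h1
  have hδ : 0 < 2 / r - 1 := by
    rw [sub_pos, one_lt_div hr]
    exact h2
  set θ := 1 - 1 / r with hθ'
  set δ := 2 / r - 1 with hδ'
  refine ⟨((δ / θ) ^ θ)⁻¹, by positivity, fun n hn => ?_⟩
  have hn0 : (0 : ℝ) < n := by positivity
  have hlog : 0 < Real.log n := Real.log_pos (by exact_mod_cast hn)
  have h3 : Real.log n ^ θ ≤ ((δ / θ) ^ θ)⁻¹ * (n : ℝ) ^ δ := by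
    have := Real.rpow_le_rpow hlog.le
      (Real.log_le_rpow_div hn0.le (show 0 < δ / θ by positivity)) hθ.le
    rw [Real.div_rpow (by positivity) (by positivity), ← Real.rpow_mul hn0.le,
      div_mul_cancel₀ _ hθ.ne'] at this
    rwa [inv_mul_eq_div]
  have h4 : ((n : ℝ) ^ 2 * Real.log n) ^ (1 / r) = n * ((n : ℝ) ^ δ) * Real.log n ^ (1 / r) := by
    rw [Real.mul_rpow (by positivity) hlog.le, ← Real.rpow_two, ← Real.rpow_mul hn0.le]
    congr 1
    rw [← Real.rpow_one_add' hn0.le (by positivity)]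
    congr 1
    rw [hδ']
    ring
  have h5 : Real.log n = Real.log n ^ θ * Real.log n ^ (1 / r) := by
    rw [← Real.rpow_add hlog, hθ', sub_add_cancel, Real.rpow_one]
  rw [h4]
  nth_rw 1 [h5]
  calc (n : ℝ) * (Real.log n ^ θ * Real.log n ^ (1 / r))
      = Real.log n ^ θ * (n * Real.log n ^ (1 / r)) := by ring
    _ ≤ (((δ / θ) ^ θ)⁻¹ * (n : ℝ) ^ δ) * (n * Real.log n ^ (1 / r)) :=
      mul_le_mul_of_nonneg_right h3 (by positivity)
    _ = _ := by ring

theorem half_le_log {n : ℕ} (hn : 2 ≤ n) : 1 / 2 ≤ Real.log n := by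
  have h1 : Real.log 2 ≤ Real.log n := Real.log_le_log (by norm_num) (by exact_mod_cast hn)
  linarith [Real.log_two_gt_d9]

/-- In a graph on `Fin l` without a copy of `H`, a set of at most `ε * l` vertices touches only a
small proportion of `l ^ r` edges. -/
theorem exists_interedges_le {W : Type*} {H : SimpleGraph W} {c r η : ℝ} (hc : 0 < c)
    (hr : 1 < r) (hr2 : r < 2) (hη : 0 < η)
    (hex : ∀ l : ℕ, (extremalNumber l H : ℝ) ≤ c * (l : ℝ) ^ r) :
    ∃ ε : ℝ, 0 < ε ∧ ε ≤ 1 ∧ ∀ (l s : ℕ) (G : SimpleGraph (Fin l)) [DecidableRel G.Adj],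
      H.Free G → 0 < s → (s : ℝ) ≤ ε * l → ∀ S : Finset (Fin l), #S ≤ s →
        (#(G.interedges S univ) : ℝ) ≤ η * (l : ℝ) ^ r := by
  have hr1 : 0 < r - 1 := by linarith
  -- The interval bound amounts to `16 c l s^(r-1) ≤ 16 c ε^(r-1) l^r`; this `ε` makes it at most `η
  -- l^r`, which needs `r > 1`.
  refine ⟨min 1 ((η / (16 * c)) ^ (1 / (r - 1))), by positivity, min_le_left _ _, ?_⟩
  set ε := min 1 ((η / (16 * c)) ^ (1 / (r - 1))) with hε
  have hε0 : 0 < ε := by positivity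
  have hε1 : ε ≤ 1 := min_le_left _ _
  have hε2 : ε ^ (r - 1) ≤ η / (16 * c) := by
    have := Real.rpow_le_rpow hε0.le (min_le_right 1 ((η / (16 * c)) ^ (1 / (r - 1)))) hr1.le
    rwa [← Real.rpow_mul (by positivity), one_div_mul_cancel hr1.ne', Real.rpow_one] at this
  intro l s G _ hG hs hsl S hS
  have hs' : (0 : ℝ) < s := mod_cast hs
  have hl : (0 : ℝ) < l := by
    by_contra! h
    nlinarith
  have hsl' : (s : ℝ) ≤ l := by nlinarith
  refine (card_interedges_univ_right_le hG hc.le (by linarith) hex hs S hS).trans ?_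
  have e1 : ((l / s : ℕ) : ℝ) + 1 ≤ 2 * (l / s) := by
    have h1 : ((l / s : ℕ) : ℝ) ≤ l / s := Nat.cast_div_le
    have h2 : (1 : ℝ) ≤ l / s := (one_le_div hs').2 hsl'
    linarith
  have e2 : (2 * s : ℝ) ^ r ≤ 4 * (s * (s : ℝ) ^ (r - 1)) := by
    rw [Real.mul_rpow (by norm_num) hs'.le, ← Real.rpow_one_add' hs'.le (by linarith),
      add_sub_cancel]
    have : (2 : ℝ) ^ r ≤ 2 ^ (2 : ℝ) := Real.rpow_le_rpow_of_exponent_le (by norm_num) hr2.le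
    have h4 : (2 : ℝ) ^ (2 : ℝ) = 4 := by norm_num
    exact mul_le_mul_of_nonneg_right (this.trans h4.le) (by positivity)
  have e3 : (s : ℝ) ^ (r - 1) ≤ η / (16 * c) * (l : ℝ) ^ (r - 1) := by
    refine (Real.rpow_le_rpow hs'.le hsl hr1.le).trans ?_
    rw [Real.mul_rpow hε0.le hl.le]
    exact mul_le_mul_of_nonneg_right hε2 (by positivity)
  have e4 : (l : ℝ) ^ r = l * (l : ℝ) ^ (r - 1) := by
    rw [← Real.rpow_one_add' hl.le (by linarith), add_sub_cancel]
  calc (((l / s : ℕ) : ℝ) + 1) * (2 * c * (2 * s : ℝ) ^ r)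
      ≤ (2 * (l / s)) * (2 * c * (4 * (s * (s : ℝ) ^ (r - 1)))) := by gcongr
    _ = 16 * c * l * (s : ℝ) ^ (r - 1) := by field_simp; ring
    _ ≤ 16 * c * l * (η / (16 * c) * (l : ℝ) ^ (r - 1)) := by gcongr
    _ = η * (l : ℝ) ^ r := by rw [e4]; field_simp

theorem f_le_of_one_lt {W : Type*} {H : SimpleGraph W} (hne : H ≠ ⊥) {c c' r : ℝ} {N : ℕ}
    (hc : 0 < c) (hc' : 0 < c') (hr : 1 < r) (hr2 : r < 2)
    (hex : ∀ l : ℕ, (extremalNumber l H : ℝ) ≤ c * (l : ℝ) ^ r)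
    (hex' : ∀ l : ℕ, N ≤ l → c' * (l : ℝ) ^ r ≤ extremalNumber l H) :
    ∃ C : ℝ, 0 < C ∧ ∀ n : ℕ, 2 ≤ n →
      (f n H : ℝ) ≤ C * (n : ℝ) ^ (2 / r - 1) * Real.log n ^ (1 / r) := by
  have hr0 : 0 < r := by linarith
  obtain ⟨K, hK, hKn⟩ := exists_mul_log_le hr hr2
  -- With `d * l = (c'/16) l^r` as well, the edges required are `2 (2/16 + 1/16) c' l^r`, less than
  -- the available `c' l^r`.
  obtain ⟨ε, hε0, hε1, htouch⟩ := exists_interedges_le hc hr hr2 (η := c' / 16) (by positivity) hex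
  -- The summands serve in turn `L ≤ L^r`, `N ≤ l`, `M ≤ s` and `n * t ≤ s`.
  set L : ℝ := 1 + N + 5 * K / ε + 160 / (ε * c') with hL
  have hK5 : 0 < 5 * K / ε := by positivity
  have h160 : 0 < 160 / (ε * c') := by positivity
  have hN0 : (0 : ℝ) ≤ N := by positivity
  have hL1 : 1 ≤ L := by linarith
  have hLN : N ≤ L := by linarith
  have hLK : 5 * K ≤ ε * L := by
    rw [← div_le_iff₀' hε0]
    linarith
  have hLc : 160 ≤ ε * c' * L := by
    rw [← div_le_iff₀' (by positivity)]
    linarith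
  refine ⟨6 * L, by positivity, fun n hn => ?_⟩
  have hn2 : (2 : ℝ) ≤ n := mod_cast hn
  have hn0 : (0 : ℝ) < n := by linarith
  have hlog := half_le_log hn
  have hlog0 : 0 < Real.log n := by linarith
  set X : ℝ := ((n : ℝ) ^ 2 * Real.log n) ^ (1 / r) with hX
  have hXK : (n : ℝ) * Real.log n ≤ K * X := hKn n hn
  have hX1 : 1 ≤ X := Real.one_le_rpow (by nlinarith) (by positivity)
  have hXr : X ^ r = (n : ℝ) ^ 2 * Real.log n := by
    rw [hX, ← Real.rpow_mul (by positivity), one_div_mul_cancel hr0.ne', Real.rpow_one]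
  set l : ℕ := ⌈L * X⌉₊ with hl
  have hLX1 : 1 ≤ L * X := one_le_mul_of_one_le_of_one_le hL1 hX1
  have hl1 : L * X ≤ l := Nat.le_ceil _
  have hl2 : (l : ℝ) ≤ 2 * (L * X) := by
    have := Nat.ceil_lt_add_one (show 0 ≤ L * X by linarith)
    linarith
  have hl0 : (0 : ℝ) < l := by linarith
  have hlN : N ≤ l := by
    have : (N : ℝ) ≤ l := (hLN.trans (le_mul_of_one_le_right (by linarith) hX1)).trans hl1
    exact_mod_cast this
  have hεl : 5 * (n * Real.log n) ≤ ε * l := by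
    have h1 : 5 * K * X ≤ ε * L * X := mul_le_mul_of_nonneg_right hLK (by linarith)
    have h2 : ε * (L * X) ≤ ε * l := mul_le_mul_of_nonneg_left hl1 hε0.le
    linarith
  have hlr : 160 * ((n : ℝ) ^ 2 * Real.log n) ≤ ε * c' * (l : ℝ) ^ r := by
    have h1 : L * X ^ r ≤ (l : ℝ) ^ r := by
      refine le_trans ?_ (Real.rpow_le_rpow (by linarith) hl1 hr0.le)
      rw [Real.mul_rpow (by linarith) (by linarith)]
      exact mul_le_mul_of_nonneg_right (Real.self_le_rpow_of_one_le hL1 hr.le) (by positivity)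
    rw [← hXr]
    have h2 : 160 * X ^ r ≤ ε * c' * L * X ^ r := mul_le_mul_of_nonneg_right hLc (by positivity)
    have h3 : ε * c' * (L * X ^ r) ≤ ε * c' * (l : ℝ) ^ r :=
      mul_le_mul_of_nonneg_left h1 (by positivity)
    linarith
  have hnlog : (n : ℝ) ≤ 2 * (n * Real.log n) := by nlinarith
  set s : ℕ := ⌊ε * l⌋₊ with hs
  have hsl : (s : ℝ) ≤ ε * l := Nat.floor_le (by positivity)
  have hs0 : 0 < s := Nat.floor_pos.2 (by linarith)
  -- The factor 3 gives `n² exp(-M/n) ≤ 1/n < 1`.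
  set M : ℕ := ⌈3 * (n * Real.log n)⌉₊ with hM
  have hM1 : 3 * (n * Real.log n) ≤ M := Nat.le_ceil _
  have hM2 : (M : ℝ) ≤ 5 * (n * Real.log n) := by
    have := Nat.ceil_lt_add_one (show 0 ≤ 3 * (n * Real.log n) by positivity)
    linarith
  set d : ℝ := c' / 16 * (l : ℝ) ^ (r - 1) with hd
  have hd0 : 0 < d := by positivity
  have hdl : d * l = c' / 16 * (l : ℝ) ^ r := by
    rw [hd, mul_assoc, mul_comm _ (l : ℝ), ← Real.rpow_one_add' hl0.le (by linarith),
      add_sub_cancel]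
  set t : ℕ := ⌈M / d⌉₊ with ht
  have ht1 : M ≤ t * d := (div_le_iff₀ hd0).1 (Nat.le_ceil _)
  have ht2 : (t : ℝ) ≤ M / d + 1 := (Nat.ceil_lt_add_one (by positivity)).le
  have hnt : (n : ℝ) * t ≤ ε * l := by
    have h1 : (n : ℝ) * (M / d) ≤ ε * l / 2 := by
      rw [mul_div_assoc', div_le_iff₀ hd0]
      have h2 : ε * l / 2 * d = ε * c' * (l : ℝ) ^ r / 32 := by
        rw [show ε * l / 2 * d = ε / 2 * (d * l) by ring, hdl]
        ring
      rw [h2]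
      have h3 := mul_le_mul_of_nonneg_left hM2 hn0.le
      linarith
    have h2 := mul_le_mul_of_nonneg_left ht2 hn0.le
    linarith
  obtain ⟨G, hdec, hGext⟩ := exists_isExtremal_free (V := Fin l) hne
  have hcard := card_edgeFinset_of_isExtremal_free hGext
  rw [Fintype.card_fin] at hcard
  have hlrpos : 0 < (l : ℝ) ^ r := by positivity
  have hres := exists_isNKGraph_of_dense (n := n) (s := s) (t := t) (M := M) hGext.prop
    (fun S hS => htouch l s G hGext.prop hs0 hsl S hS) hd0.le
    (by
      rw [hdl, hcard]
      refine lt_of_lt_of_le ?_ (hex' l hlN)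
      linarith [mul_pos hc' hlrpos])
    (by omega) (Nat.le_floor (by linarith)) ht1 (Nat.le_floor (by push_cast; exact hnt))
    (by
      have h1 : -(M / n : ℝ) ≤ -Real.log n + (-Real.log n + -Real.log n) := by
        have : 3 * Real.log n ≤ M / n := by
          rw [le_div_iff₀ hn0]
          linarith
        linarith
      have h2 := Real.exp_le_exp.2 h1
      rw [Real.exp_add, Real.exp_add, Real.exp_neg (Real.log n), Real.exp_log hn0] at h2
      calc (n : ℝ) * n * Real.exp (-(M / n : ℝ))
          ≤ (n : ℝ) * n * ((n : ℝ)⁻¹ * ((n : ℝ)⁻¹ * (n : ℝ)⁻¹)) := by gcongr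
        _ = (n : ℝ)⁻¹ := by field_simp
        _ < 1 := inv_lt_one_of_one_lt₀ (by linarith))
  have hf : (f n H : ℝ) ≤ t + ((l / n : ℕ) + 1) := by
    exact_mod_cast f_le (by positivity) hres
  have hXn : X = n * ((n : ℝ) ^ (2 / r - 1) * Real.log n ^ (1 / r)) := by
    rw [hX, Real.mul_rpow (by positivity) hlog0.le, ← Real.rpow_two, ← Real.rpow_mul hn0.le,
      ← mul_assoc, ← Real.rpow_one_add' hn0.le (by rw [add_sub_cancel]; positivity)]
    congr 2
    ring
  have hdiv : ((l / n : ℕ) : ℝ) ≤ l / n := Nat.cast_div_le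
  have hεl' : ε * l ≤ l := mul_le_of_le_one_left hl0.le hε1
  have hln : (n : ℝ) ≤ l := by linarith
  -- Each of `n * t`, `n * (l / n)` and `n` is at most `l`.
  have h3 : (n : ℝ) * f n H ≤ 3 * l := by
    have h4 : (n : ℝ) * (l / n) = l := by field_simp
    have h6 := mul_le_mul_of_nonneg_left hf hn0.le
    have h7 := mul_le_mul_of_nonneg_left hdiv hn0.le
    linarith
  have h8 : (n : ℝ) * f n H ≤
      n * (6 * L * (n : ℝ) ^ (2 / r - 1) * Real.log n ^ (1 / r)) := by
    have : 6 * (L * X) = n * (6 * L * (n : ℝ) ^ (2 / r - 1) * Real.log n ^ (1 / r)) := by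
      rw [hXn]
      ring
    linarith
  exact le_of_mul_le_mul_left h8 hn0

/-! ### The lower bound and the conclusion -/

theorem le_f {W : Type*} [Fintype W] {H : SimpleGraph W} [DecidableRel H.Adj]
    (hdeg : 2 ≤ H.maxDegree) {c r : ℝ} (hc : 0 < c) (hr : 0 < r)
    (hex : ∀ l : ℕ, (extremalNumber l H : ℝ) ≤ c * (l : ℝ) ^ r) {n : ℕ} (hn : 2 ≤ n) :
    (1 / (4 * c)) ^ (1 / r) * (n : ℝ) ^ (2 / r - 1) ≤ f n H := by
  have h := mul_pred_le_of_isNKGraph hc.le hr.le hex (f_spec hdeg (by omega : 0 < n))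
  have hn2 : (2 : ℝ) ≤ n := mod_cast hn
  have hn0 : (0 : ℝ) < n := by linarith
  rw [Nat.cast_sub (by omega), Nat.cast_one] at h
  -- Uses `n - 1 ≥ n / 2`, which turns `2c` into `4c`.
  have h1 : 1 / (4 * c) * (n : ℝ) ^ (2 : ℝ) ≤ ((n : ℝ) * f n H) ^ r := by
    rw [Real.rpow_two, one_div, inv_mul_le_iff₀ (by positivity)]
    nlinarith
  have h2 := Real.rpow_le_rpow (by positivity) h1 (show 0 ≤ 1 / r by positivity)
  rw [← Real.rpow_mul (by positivity), mul_one_div_cancel hr.ne', Real.rpow_one,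
    Real.mul_rpow (by positivity) (by positivity), ← Real.rpow_mul hn0.le] at h2
  rw [Real.rpow_sub hn0, Real.rpow_one, mul_div_assoc', div_le_iff₀ hn0, mul_comm (f n H : ℝ)]
  rwa [mul_one_div] at h2

end SplitGraph

theorem corollary2 {W : Type*} [Fintype W] (H : SimpleGraph W) [DecidableRel H.Adj]
    (hbip : H.IsBipartite) (hdeg : 2 ≤ H.maxDegree) (r : ℝ)
    (hex : (fun l : ℕ => (SimpleGraph.extremalNumber l H : ℝ)) =Θ[Filter.atTop]
      (fun l : ℕ => (l : ℝ) ^ r)) :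
    ∃ C' C : ℝ, 0 < C' ∧ 0 < C ∧ ∀ n : ℕ, 2 ≤ n →
      C' * (n : ℝ) ^ (2 / r - 1) ≤ (SplitGraph.f n H : ℝ) ∧
      (SplitGraph.f n H : ℝ) ≤ C * (n : ℝ) ^ (2 / r - 1) * Real.log n ^ (1 / r) := by
  have hne : H ≠ ⊥ := by
    rintro rfl
    have : (⊥ : SimpleGraph W).maxDegree ≤ 0 :=
      SimpleGraph.maxDegree_le_of_forall_degree_le _ _ fun v => by
        rw [← SimpleGraph.card_neighborFinset_eq_degree, Nat.le_zero, Finset.card_eq_zero]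
        ext w
        simp
    omega
  obtain ⟨c, hc, hle⟩ := SplitGraph.exists_forall_extremalNumber_le hex.1
  obtain ⟨c', hc', N, hge⟩ := SplitGraph.exists_le_extremalNumber hex.2
  have hr1 := SplitGraph.one_le_of_extremalNumber_le hdeg hc hle
  have hr2 := SplitGraph.lt_two_of_le_extremalNumber hbip hne hc' hge
  have hr0 : 0 < r := by linarith
  obtain ⟨C, hC, hupper⟩ : ∃ C : ℝ, 0 < C ∧ ∀ n : ℕ, 2 ≤ n →
      (SplitGraph.f n H : ℝ) ≤ C * (n : ℝ) ^ (2 / r - 1) * Real.log n ^ (1 / r) := by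
    rcases hr1.eq_or_lt with rfl | hr1
    -- For `r = 1` the target is `C n log n`; the matching gives `f n H ≤ n`, and `log n ≥ 1/2`
    -- makes `C = 2` enough.
    · refine ⟨2, by norm_num, fun n hn => ?_⟩
      have h1 : (SplitGraph.f n H : ℝ) ≤ n := mod_cast SplitGraph.f_le_self hdeg (by omega)
      have h2 := SplitGraph.half_le_log hn
      have hn0 : (0 : ℝ) < n := by positivity
      norm_num
      nlinarith
    · exact SplitGraph.f_le_of_one_lt hne hc hc' hr1 hr2 hle hge
  exact ⟨(1 / (4 * c)) ^ (1 / r), C, by positivity, hC, fun n hn =>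
    ⟨SplitGraph.le_f hdeg hc hr0 hle hn, hupper n hn⟩⟩
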